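/- Let $d\ge 1$, $\alpha>0$, $\lambda>0$, let $W$ be a distribution with $\mathbb P(W\ge 1)=1$ and $L$ a distribution on $[0,\infty)$. Let $(W_x)_{x\in\mathbb Z^d}$ be i.i.d. copies of $W$ (the environment), and for $x\ne y$ put $r_{xy}=\lambda W_xW_y/\|x-y\|^{\alpha}$ (Euclidean norm), $r_{xx}=0$. Consider the following three processes. * $\mathrm{SFP}_{W,L}$: the random graph on $\mathbb Z^d$ in which, given the environment, the edges are independently present, $\{x,y\}$ with probability $1$ if $\|x-y\|=1$ and $1-e^{-r_{xy}}$ if $\|x-y\|>1$; all edges carry i.i.d. edge-weights with distribution $L$. The $L$-length of a path is the sum of its edge-weights. $\mathcal B^{L,S}_t(0)$ is the tree formed by the vertices and edges on shortest paths (paths of minimal $L$-length between their endpoints) of $L$-length at most $t$ from $0$, including vertex-weights and edge-weights. If a vertex has several shortest paths from $0$, the tree uses the one with the fewest edges, remaining ties being broken lexicographically according to a fixed enumeration of $\mathbb Z^d$. * $\mathrm{PoiBRW}$: a branching random walk in the environment. The root is located at $0$. Given the environment, an individual located at $x$ has, independently for all individuals and all $y\in\mathbb Z^d$, $\mathrm{Poi}(r_{xy})$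 children located at $y$, and in addition one child at each $y$ with $\|x-y\|=1$. All parent–child edges carry i.i.d. edge-weights with distribution $L$; an individual at $y$ has vertex-weight $W_y$. * $\mathrm{BerBRW}$: the same, except that an individual at $x$ has one child at $y$ with probability $1$ if $\|x-y\|=1$ and with probability $1-e^{-r_{xy}}$ otherwise, and no child at $y$ else. $\mathcal B^{L,P}_t(0)$ and $\mathcal B^{L,B}_t(0)$ denote the trees spanned by the individuals of $\mathrm{PoiBRW}$ and $\mathrm{BerBRW}$ within $L$-distance $t$ of the root, including locations, vertex-weights and edge-weights. Theorem. There is a coupling of $\mathrm{PoiBRW}$, $\mathrm{BerBRW}$ and $\mathrm{SFP}_{W,L}$ on one probability space, with the same environment, in which $\mathrm{BerBRW}$ is a thinning of $\mathrm{PoiBRW}$ (each of its individuals keeps exactly one child, with its edge-weight, at every site at which she has at least one child in $\mathrm{PoiBRW}$; at a nearest-neighbor site the kept child is the additional one), such that almost surely, for all $t\ge 0$, $$\mathcal B^{L,S}_t(0)\subseteq \mathcal B^{L,B}_t(0)\subseteq \mathcal B^{L,P}_t(0).$$ The second inclusion is one of sets of individuals with their edges, locations and weights. The first means that $\mathcal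 B^{L,S}_t(0)$ is embedded in $\mathcal B^{L,B}_t(0)$ as a subtree by an injective map (the same for all $t$) that sends $0$ to the root, sends edges (directed away from $0$) to parent–child edges, and preserves locations, vertex-weights and edge-weights. -/

import Mathlib

open MeasureTheory ProbabilityTheory
open scoped ENNReal NNReal

noncomputable section

namespace SFPCoupling

/-! ### The lattice, the environment and the connection rates -/

/-- The lattice `ℤ ^ d`. -/
abbrev Site (d : ℕ) := Fin d → ℤ

/-- An environment: one vertex-weight for every site. -/
abbrev Env (d : ℕ) := Site d → ℝ

variable {d : ℕ}

/-- Euclidean distance of two sites. -/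
def eucl (x y : Site d) : ℝ := Real.sqrt (∑ i, ((x i : ℝ) - (y i : ℝ)) ^ 2)

theorem eucl_comm (x y : Site d) : eucl x y = eucl y x := by
  unfold eucl
  congr 1
  exact Finset.sum_congr rfl fun i _ => by ring

/-- The rate `lam * W_x * W_y / ‖x - y‖ ^ α` for `x ≠ y`, and `0` for `x = y`. -/
def rate (α lam : ℝ) (w : Env d) (x y : Site d) : ℝ≥0 :=
  if x = y then 0 else (lam * (w x * w y) / eucl x y ^ α).toNNReal

theorem rate_comm (α lam : ℝ) (w : Env d) (x y : Site d) :
    rate α lam w x y = rate α lam w y x := by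
  unfold rate
  rw [eucl_comm, mul_comm (w x)]
  simp only [eq_comm]

open Classical in
/-- The connection probability of `x` and `y` given the environment: `1` for nearest neighbours,
`1 - exp (- lam * W_x * W_y / ‖x - y‖ ^ α)` for other pairs of distinct sites, `0` for `x = y`. -/
def connProb (α lam : ℝ) (w : Env d) (x y : Site d) : unitInterval :=
  if eucl x y = 1 then 1
  else ⟨1 - Real.exp (-(rate α lam w x y : ℝ)), by
    constructor
    · have : Real.exp (-(rate α lam w x y : ℝ)) ≤ 1 :=
        Real.exp_le_one_iff.2 (neg_nonpos.2 (NNReal.coe_nonneg _))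
      linarith
    · have := Real.exp_pos (-(rate α lam w x y : ℝ))
      linarith⟩

theorem connProb_comm (α lam : ℝ) (w : Env d) (x y : Site d) :
    connProb α lam w x y = connProb α lam w y x := by
  unfold connProb
  simp only [eucl_comm x y, rate_comm α lam w x y]

/-- The connection probability of an unordered pair of sites. -/
def connProbSym (α lam : ℝ) (w : Env d) : Sym2 (Site d) → unitInterval :=
  Sym2.lift ⟨connProb α lam w, connProb_comm α lam w⟩

/-- `X` is a random element whose law in the i.i.d. environment `W` (with marginal law `ν`) is the
family `Q`: the vertex-weights `W x` are i.i.d. with law `ν`, and conditionally on `W = w` the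
law of `X` is `Q w`. -/
def HasLawInEnv {Ω S : Type} [MeasurableSpace Ω] [MeasurableSpace S] (P : Measure Ω)
    (ν : Measure ℝ) (W : Ω → Env d) (X : Ω → S) (Q : Env d → Measure S) : Prop :=
  Measurable W ∧ Measurable X ∧
    ∀ (A : Set (Env d)) (B : Set S), MeasurableSet A → MeasurableSet B →
      P (W ⁻¹' A ∩ X ⁻¹' B) = ∫⁻ w in A, Q w B ∂(Measure.infinitePi fun _ : Site d => ν)

/-! ### Scale-free percolation with edge-weights -/

/-- A sample of the edges: for each unordered pair of sites, whether the edge is present, and an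
edge-weight (which only matters if the edge is present). -/
abbrev EdgeConf (d : ℕ) := (Sym2 (Site d) → Bool) × (Sym2 (Site d) → ℝ)

/-- The conditional law of scale-free percolation with edge-weights given the environment `w`:
edges are independently present with the connection probabilities, and the edge-weights are
i.i.d. with law `ρ`. -/
def sfpLaw (α lam : ℝ) (ρ : Measure ℝ) (w : Env d) : Measure (EdgeConf d) :=
  (Measure.infinitePi fun e : Sym2 (Site d) =>
      bernoulliMeasure true false (connProbSym α lam w e)).prod
    (Measure.infinitePi fun _ : Sym2 (Site d) => ρ)

/-- The graph formed by the edges that are present. -/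
def sfpGraph (s : EdgeConf d) : SimpleGraph (Site d) :=
  SimpleGraph.fromEdgeSet {e | s.1 e = true}

/-- The `L`-length of a walk: the sum of its edge-weights. -/
def lLength (s : EdgeConf d) {x y : Site d} (p : (sfpGraph s).Walk x y) : ℝ :=
  (p.edges.map s.2).sum

/-- `p` is a path of minimal `L`-length between its endpoints. -/
def IsShortest (s : EdgeConf d) {x y : Site d} (p : (sfpGraph s).Walk x y) : Prop :=
  p.IsPath ∧ ∀ q : (sfpGraph s).Walk x y, q.IsPath → lLength s p ≤ lLength s q

/-- `p` is the shortest path between its endpoints, where ties between several paths of minimal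
`L`-length are broken by the number of edges and then lexicographically, according to the
enumeration `e` of the sites. If there is only one path of minimal `L`-length, this is that path. -/
def IsTreePath (e : Site d ↪ ℕ) (s : EdgeConf d) {x y : Site d}
    (p : (sfpGraph s).Walk x y) : Prop :=
  IsShortest s p ∧ ∀ q : (sfpGraph s).Walk x y, IsShortest s q →
    p.length < q.length ∨ (p.length = q.length ∧ p.support.map e ≤ q.support.map e)

/-! ### Rooted weighted graphs embedded in the lattice -/

/-- A rooted graph with vertices of type `V`, located in `ℤ ^ d`, with vertex-weights and
edge-weights; edges are directed away from the root. -/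
structure SpatialGraph (d : ℕ) (V : Type) where
  root : V
  verts : Set V
  edge : V → V → Prop
  loc : V → Site d
  vertexWeight : V → ℝ
  edgeWeight : V → V → ℝ

/-- `φ` realises `G` as a subgraph of `H`: it maps the vertices of `G` injectively to vertices of
`H` and the edges of `G` to edges of `H`, and it preserves the root, the locations, the
vertex-weights and the edge-weights. -/
structure SpatialGraph.IsSubgraphVia {V V' : Type} (φ : V → V') (G : SpatialGraph d V)
    (H : SpatialGraph d V') : Prop where
  map_root : φ G.root = H.root
  mapsTo : Set.MapsTo φ G.verts H.verts
  injOn : Set.InjOn φ G.verts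
  map_loc : ∀ x ∈ G.verts, H.loc (φ x) = G.loc x
  map_vertexWeight : ∀ x ∈ G.verts, H.vertexWeight (φ x) = G.vertexWeight x
  map_edge : ∀ x y, G.edge x y → H.edge (φ x) (φ y)
  map_edgeWeight : ∀ x y, G.edge x y → H.edgeWeight (φ x) (φ y) = G.edgeWeight x y

/-- The shortest-path tree of the origin up to `L`-distance `t`: all vertices and edges on the
shortest paths (with ties broken as above) of `L`-length at most `t` that start at `0`. -/
def shortestPathTree (e : Site d ↪ ℕ) (w : Env d) (s : EdgeConf d) (t : ℝ) :
    SpatialGraph d (Site d) where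
  root := 0
  verts := {x | ∃ (z : Site d) (p : (sfpGraph s).Walk 0 z),
    IsTreePath e s p ∧ lLength s p ≤ t ∧ x ∈ p.support}
  edge x y := ∃ (z : Site d) (p : (sfpGraph s).Walk 0 z),
    IsTreePath e s p ∧ lLength s p ≤ t ∧ (x, y) ∈ p.darts.map SimpleGraph.Dart.toProd
  loc x := x
  vertexWeight x := w x
  edgeWeight x y := s.2 s(x, y)

/-! ### Branching random walks -/

/-- Names of individuals: `[]` is the root and `(y, k) :: a` is the child of `a` that has number
`k` (counting from `0`) among the children of `a` that are located at `y`. -/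
abbrev Indiv (d : ℕ) := List (Site d × ℕ)

/-- The location of an individual; the root is at the origin. -/
def Indiv.site : Indiv d → Site d
  | [] => 0
  | (y, _) :: _ => y

/-- A sample of a branching random walk: the number of children that an individual has at a site,
and the edge-weight between an individual and her parent. Both are given for all conceivable
names, but they only matter for the individuals that are born. -/
abbrev BRWConf (d : ℕ) := (Indiv d × Site d → ℕ) × (Indiv d → ℝ)

/-- The individual is present in the branching random walk. -/
def Born (c : BRWConf d) : Indiv d → Prop
  | [] => True
  | (y, k) :: a => k < c.1 (a, y) ∧ Born c a

/-- The `L`-distance of an individual from the root. -/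
def rootDist (c : BRWConf d) : Indiv d → ℝ
  | [] => 0
  | b :: a => rootDist c a + c.2 (b :: a)

/-- The graph spanned by the individuals within `L`-distance `t` of the root. -/
def brwBall (w : Env d) (c : BRWConf d) (t : ℝ) : SpatialGraph d (Indiv d) where
  root := []
  verts := {a | Born c a ∧ rootDist c a ≤ t}
  edge a b := (Born c a ∧ rootDist c a ≤ t) ∧ (Born c b ∧ rootDist c b ≤ t) ∧
    ∃ m : Site d × ℕ, b = m :: a
  loc a := Indiv.site a
  vertexWeight a := w (Indiv.site a)
  edgeWeight _ b := c.2 b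

open Classical in
/-- The law of the number of children at `y` of an individual located at `x` in the Poisson
branching random walk: a Poisson variable, plus one additional child if `y` is a nearest neighbour
of `x`. The additional child has number `0`. -/
def poiOffspring (α lam : ℝ) (w : Env d) (x y : Site d) : Measure ℕ :=
  if eucl x y = 1 then (poissonMeasure (rate α lam w x y)).map (fun n => n + 1)
  else poissonMeasure (rate α lam w x y)

/-- The law of the number of children at `y` of an individual located at `x` in the Bernoulli
branching random walk: one child with the connection probability of `x` and `y`, else none. -/
def berOffspring (α lam : ℝ) (w : Env d) (x y : Site d) : Measure ℕ :=
  bernoulliMeasure 1 0 (connProb α lam w x y)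

/-- The conditional law, given the environment, of a branching random walk in which all numbers of
children are independent, with offspring law `μ x y` for the children at `y` of an individual at
`x`, and in which the edge-weights are i.i.d. with law `ρ`. -/
def brwLaw (μ : Site d → Site d → Measure ℕ) (ρ : Measure ℝ) : Measure (BRWConf d) :=
  (Measure.infinitePi fun i : Indiv d × Site d => μ (Indiv.site i.1) i.2).prod
    (Measure.infinitePi fun _ : Indiv d => ρ)

/-- The Bernoulli branching random walk `b` is the thinning of the Poisson branching random walk
`p`: each individual of `b` keeps exactly one child (the one with number `0`) at every site at
which she has at least one child in `p`, with the same edge-weight. -/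
def IsThinning (b p : BRWConf d) : Prop :=
  (∀ a y, Born b a → b.1 (a, y) = min 1 (p.1 (a, y))) ∧ ∀ a, Born b a → b.2 a = p.2 a

end SFPCoupling

end

open SFPCoupling

/-!
Mark every unordered pair of sites with a number of connections and an edge-weight; a pair is an
edge of the percolation if it has at least one connection. List the open paths from the origin by
length, then number of edges, then lexicographically. For each pair, let the first path that
reaches it lead to an individual all of whose ancestors have number `0`, and let the marks of the
pair be her number of children across it and the edge-weight to the first of these children. All
other coordinates of the branching random walk are taken from an independent sample. No pair is
used twice.

This yields the Poisson branching random walk, because whether and in which order pairs are reached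
before a given one does not depend on the marks of that pair. To see it, write the probability of a
finite-dimensional box as the mean of a product of factors, each a mean plus a centred indicator
on the event that the coordinate is revealed, and expand: split each term with a centred indicator
according to which coordinate is revealed last; resampling that one alone leaves everything else
unchanged, so the term vanishes.

The shortest path to a site, ties being broken, is the first open path to it. Each of its initial
pieces is the first path to reach the next edge, so the individuals along it are born, carry the
edge-weights of the percolation, and survive the thinning, which keeps the children with number `0`.
-/

namespace SFPCoupling

/-! ### Infinite products of probability measures -/

section InfiniteProducts

variable {ι : Type*} {X : ι → Type*} [∀ i, MeasurableSpace (X i)]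

theorem measurable_infinitePi {Θ : Type*} [MeasurableSpace Θ] {μ : Θ → ∀ i, Measure (X i)}
    [∀ w i, IsProbabilityMeasure (μ w i)] (hμ : ∀ i, Measurable fun w => μ w i) :
    Measurable fun w => Measure.infinitePi (μ w) := by
  refine Measurable.measure_of_isPiSystem_of_isProbabilityMeasure
    generateFrom_squareCylinders.symm
    (isPiSystem_squareCylinders (fun _ => MeasurableSpace.isPiSystem_measurableSet)
      fun _ => .univ) ?_
  rintro _ ⟨s, a, ha, rfl⟩
  have ha' : ∀ i, MeasurableSet (a i) := fun i => ha i (Set.mem_univ i)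
  simp_rw [Measure.infinitePi_pi _ fun i _ => ha' i]
  exact Finset.measurable_fun_prod s fun i _ => (Measure.measurable_coe (ha' i)).comp (hμ i)

theorem measurePreserving_sumPiEquivProdPi_infinitePi {κ : Type*} {Y : ι ⊕ κ → Type*}
    [∀ i, MeasurableSpace (Y i)] (μ : ∀ i, Measure (Y i)) [∀ i, IsProbabilityMeasure (μ i)] :
    MeasurePreserving (MeasurableEquiv.sumPiEquivProdPi Y) (Measure.infinitePi μ)
      ((Measure.infinitePi fun i => μ (.inl i)).prod (Measure.infinitePi fun k => μ (.inr k))) := by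
  refine MeasurePreserving.symm (MeasurableEquiv.sumPiEquivProdPi Y).symm
    ⟨MeasurableEquiv.measurable _, Measure.eq_infinitePi _ fun s t ht => ?_⟩
  rw [MeasurableEquiv.map_apply]
  have hbox : (MeasurableEquiv.sumPiEquivProdPi Y).symm ⁻¹' (s : Set (ι ⊕ κ)).pi t =
      (s.toLeft : Set ι).pi (fun i => t (.inl i)) ×ˢ
        (s.toRight : Set κ).pi fun k => t (.inr k) := by
    ext p
    simp [Set.mem_pi, MeasurableEquiv.sumPiEquivProdPi, Equiv.sumPiEquivProdPi]
  rw [hbox, Measure.prod_prod, Measure.infinitePi_pi _ fun i _ => ht _,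
    Measure.infinitePi_pi _ fun k _ => ht _, ← Finset.prod_disjSum (f := fun i => μ i (t i)),
    Finset.toLeft_disjSum_toRight]

theorem measurePreserving_map_infinitePi {Y : ι → Type*} [∀ i, MeasurableSpace (Y i)]
    (μ : ∀ i, Measure (X i)) [∀ i, IsProbabilityMeasure (μ i)] {f : ∀ i, X i → Y i}
    (hf : ∀ i, Measurable (f i)) :
    MeasurePreserving (fun x i => f i (x i)) (Measure.infinitePi μ)
      (Measure.infinitePi fun i => (μ i).map (f i)) :=
  ⟨by fun_prop, Measure.infinitePi_map_pi μ hf⟩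

variable [DecidableEq ι] (μ : ∀ i, Measure (X i)) [∀ i, IsProbabilityMeasure (μ i)]

theorem measurePreserving_update_infinitePi (i : ι) :
    MeasurePreserving (fun p : (∀ j, X j) × X i => Function.update p.1 i p.2)
      ((Measure.infinitePi μ).prod (μ i)) (Measure.infinitePi μ) := by
  have hupdate : Measurable fun p : (∀ j, X j) × X i => Function.update p.1 i p.2 :=
    measurable_update'
  refine ⟨hupdate, Measure.eq_infinitePi _ fun s t ht => ?_⟩
  rw [Measure.map_apply hupdate (.pi s.countable_toSet fun j _ => ht j)]
  have hbox : (fun p : (∀ j, X j) × X i => Function.update p.1 i p.2) ⁻¹' (s : Set ι).pi t =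
      (s.erase i : Set ι).pi t ×ˢ (if i ∈ s then t i else Set.univ) := by
    ext ⟨x, u⟩
    simp only [Set.mem_preimage, Set.mem_pi, Set.mem_prod, Finset.mem_coe]
    grind [Function.update]
  rw [hbox, Measure.prod_prod, Measure.infinitePi_pi _ fun j _ => ht j]
  split_ifs with hi
  · exact Finset.prod_erase_mul s (fun j => μ j (t j)) hi
  · simp [Finset.erase_eq_of_notMem hi]

theorem integral_mul_eval_infinitePi_of_update_eq {i : ι} {h : (∀ j, X j) → ℝ} {g : X i → ℝ}
    (hh : Measurable h) (hg : Measurable g)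
    (hinv : ∀ x u, h (Function.update x i u) = h x) :
    ∫ x, h x * g (x i) ∂Measure.infinitePi μ =
      (∫ x, h x ∂Measure.infinitePi μ) * ∫ u, g u ∂μ i := by
  have hupdate := measurePreserving_update_infinitePi μ i
  have hmeas : Measurable fun x : ∀ j, X j => h x * g (x i) := by fun_prop
  rw [← hupdate.map_eq, integral_map hupdate.measurable.aemeasurable
    hmeas.aestronglyMeasurable, hupdate.map_eq, ← integral_prod_mul]
  simp only [hinv, Function.update_self]

end InfiniteProducts

section Expansion

variable {Ω I : Type*} [MeasurableSpace Ω] {P : Measure Ω} [IsProbabilityMeasure P]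

theorem integral_prod_const_add (J : Finset I) (m : I → ℝ) (q : I → Ω → ℝ)
    (hint : ∀ T ⊆ J, Integrable (fun ω => ∏ i ∈ T, q i ω) P)
    (hzero : ∀ T ⊆ J, T.Nonempty → ∫ ω, ∏ i ∈ T, q i ω ∂P = 0) :
    ∫ ω, ∏ i ∈ J, (m i + q i ω) ∂P = ∏ i ∈ J, m i := by
  classical
  simp_rw [Finset.prod_add]
  rw [integral_finsetSum _ fun T _ => (hint _ Finset.sdiff_subset).const_mul _]
  simp_rw [integral_const_mul]
  rw [Finset.sum_eq_single_of_mem J (Finset.mem_powerset_self J)]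
  · simp
  · intro T hT hne
    have hT' := Finset.mem_powerset.1 hT
    rw [hzero (J \ T) Finset.sdiff_subset, mul_zero]
    exact Finset.sdiff_nonempty.2 fun h => hne (hT'.antisymm h)

theorem integrable_prod_of_abs_le_one {f : I → Ω → ℝ} (hf : ∀ i, Measurable (f i))
    (hbound : ∀ i ω, |f i ω| ≤ 1) (J : Finset I) : Integrable (fun ω => ∏ i ∈ J, f i ω) P := by
  refine .of_bound (Finset.measurable_fun_prod J fun i _ => hf i).aestronglyMeasurable 1
    (ae_of_all _ fun ω => ?_)
  rw [Real.norm_eq_abs, Finset.abs_prod]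
  exact Finset.prod_le_one (fun i _ => abs_nonneg _) fun i _ => hbound i ω

end Expansion

section CentredIndicator

variable {S : Type*} [MeasurableSpace S] (m : Measure S) {a : Set S}

/-- The indicator function of a set minus the measure of that set. -/
noncomputable def centredIndicator (a : Set S) (x : S) : ℝ := a.indicator 1 x - m.real a

theorem measurable_centredIndicator (ha : MeasurableSet a) : Measurable (centredIndicator m a) :=
  (measurable_one.indicator ha).sub_const _

variable [IsProbabilityMeasure m]

theorem integral_centredIndicator (ha : MeasurableSet a) : ∫ x, centredIndicator m a x ∂m = 0 := by
  unfold centredIndicator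
  rw [integral_sub ((integrable_indicator_iff ha).2 (integrable_const 1).integrableOn)
    (integrable_const _), integral_indicator_one ha]
  simp

theorem abs_centredIndicator_le_one (a : Set S) (x : S) : |centredIndicator m a x| ≤ 1 := by
  have hnonneg : 0 ≤ m.real a := measureReal_nonneg
  have hle : m.real a ≤ 1 := measureReal_le_one
  by_cases hx : x ∈ a <;> simp [centredIndicator, hx, abs_le] <;> linarith

theorem measureReal_add_indicator_centredIndicator_mem_Icc {Ω : Type*} (s : Set Ω) (x : Ω → S)
    (a : Set S) (ω : Ω) :
    m.real a + s.indicator (fun ω => centredIndicator m a (x ω)) ω ∈ Set.Icc 0 1 := by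
  by_cases hs : ω ∈ s
  · by_cases ha : x ω ∈ a <;> simp [centredIndicator, hs, ha]
  · simp [hs, measureReal_le_one]

end CentredIndicator

/-! ### Explorations of an independent family -/

section Exploration

variable {E I K : Type*} {X : E → Type*} [LinearOrder K] {e : I → E}
  {G : I → Set (∀ ε, X ε)} {R : (∀ ε, X ε) → I → K}

open Classical in
/-- The coordinates `c i` of a second configuration are overwritten by the coordinates `z (e i)` of
the first one, for those `i` that `z` reveals, in the sense that `z ∈ G i`. -/
noncomputable def explore (e : I → E) (G : I → Set (∀ ε, X ε))
    (p : (∀ ε, X ε) × (∀ i, X (e i))) (i : I) : X (e i) :=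
  if p.1 ∈ G i then p.1 (e i) else p.2 i

/-- The event that all the `i ∈ J` are revealed, with `k` having the largest rank. -/
def lastRevealed (G : I → Set (∀ ε, X ε)) (R : (∀ ε, X ε) → I → K) (J : Finset I) (k : I) :
    Set (∀ ε, X ε) :=
  {z | ∀ j ∈ J, z ∈ G j ∧ R z j ≤ R z k}

theorem prod_indicator_eq_sum_lastRevealed (hR : ∀ z, Set.InjOn (R z) {i | z ∈ G i})
    {J : Finset I} (hJ : J.Nonempty) (f : I → (∀ ε, X ε) → ℝ) (z : ∀ ε, X ε) :
    ∏ j ∈ J, (G j).indicator (f j) z =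
      ∑ k ∈ J, (lastRevealed G R J k).indicator (fun z => ∏ j ∈ J, f j z) z := by
  by_cases hG : ∀ j ∈ J, z ∈ G j
  · obtain ⟨k, hk, hmax⟩ := J.exists_max_image (R z) hJ
    rw [Finset.sum_eq_single_of_mem k hk,
      Set.indicator_of_mem (show z ∈ lastRevealed G R J k from fun j hj => ⟨hG j hj, hmax j hj⟩)]
    · exact Finset.prod_congr rfl fun j hj => Set.indicator_of_mem (hG j hj) _
    · refine fun i hi hik => Set.indicator_of_notMem (fun h => hik ?_) _
      exact hR z (hG i hi) (hG k hk) ((hmax i hi).antisymm (h k hk).2)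
  · push Not at hG
    obtain ⟨j, hj, hGj⟩ := hG
    rw [Finset.prod_eq_zero hj (Set.indicator_of_notMem hGj _), Finset.sum_eq_zero]
    exact fun k _ => Set.indicator_of_notMem (fun h => hGj (h j hj).1) _

variable [∀ ε, MeasurableSpace (X ε)] (μ : ∀ ε, Measure (X ε)) [∀ ε, IsProbabilityMeasure (μ ε)]

theorem infinitePi_explore_preimage (z : ∀ ε, X ε) {J : Finset I} {a : ∀ i, Set (X (e i))}
    (ha : ∀ i, MeasurableSet (a i)) :
    Measure.infinitePi (fun i => μ (e i)) (Prod.mk z ⁻¹' (explore e G ⁻¹' (J : Set I).pi a)) =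
      ENNReal.ofReal (∏ j ∈ J, ((μ (e j)).real (a j) +
        (G j).indicator (fun z => centredIndicator (μ (e j)) (a j) (z (e j))) z)) := by
  classical
  have hsection : Prod.mk z ⁻¹' (explore e G ⁻¹' (J : Set I).pi a) =
      (J : Set I).pi fun i => if z ∈ G i then {_u | z (e i) ∈ a i} else a i := by
    ext c
    simp only [Set.mem_preimage, Set.mem_pi, explore]
    grind
  have hfactor : ∀ i, μ (e i) (if z ∈ G i then {_u | z (e i) ∈ a i} else a i) =
      ENNReal.ofReal ((μ (e i)).real (a i) +
        (G i).indicator (fun z => centredIndicator (μ (e i)) (a i) (z (e i))) z) := by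
    intro i
    by_cases hzG : z ∈ G i
    · by_cases hza : z (e i) ∈ a i <;> simp [centredIndicator, hzG, hza]
    · simp [hzG]
  rw [hsection, Measure.infinitePi_pi, ENNReal.ofReal_prod_of_nonneg fun i _ =>
    (measureReal_add_indicator_centredIndicator_mem_Icc _ _ _ _ _).1]
  · exact Finset.prod_congr rfl fun i _ => hfactor i
  · intro i _
    split_ifs
    exacts [.const _, ha i]

variable [DecidableEq E]

variable (e G R) in
/-- Which `i` are revealed does not depend on the coordinates that they reveal: with respect to the
ranks `R`, changing the coordinate revealed by `i` affects none of the `j` up to `i`. -/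
structure IsExploration : Prop where
  measurableSet : ∀ i, MeasurableSet (G i)
  measurableSet_rank_le : ∀ i j, MeasurableSet {z | R z i ≤ R z j}
  rank_injOn : ∀ z, Set.InjOn (R z) {i | z ∈ G i}
  injOn : ∀ z, Set.InjOn e {i | z ∈ G i}
  update : ∀ ⦃z i j⦄ u, z ∈ G i → z ∈ G j → R z j ≤ R z i →
    Function.update z (e i) u ∈ G j ∧ R (Function.update z (e i) u) j = R z j

namespace IsExploration

variable (h : IsExploration e G R)
include h

theorem measurable_explore : Measurable (explore e G) := by
  classical
  exact measurable_pi_lambda _ fun i =>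
    Measurable.ite (measurable_fst (h.measurableSet i)) (by fun_prop) (by fun_prop)

theorem measurableSet_lastRevealed (J : Finset I) (k : I) :
    MeasurableSet (lastRevealed G R J k) := by
  simp only [lastRevealed, Set.ofPred_forall]
  exact Finset.measurableSet_biInter J fun j _ =>
    (h.measurableSet j).inter (h.measurableSet_rank_le j k)

theorem update_mem_lastRevealed_iff {J : Finset I} {k : I} (hk : k ∈ J) (z : ∀ ε, X ε)
    (u : X (e k)) :
    Function.update z (e k) u ∈ lastRevealed G R J k ↔ z ∈ lastRevealed G R J k := by
  have update_mem : ∀ z u, z ∈ lastRevealed G R J k →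
      Function.update z (e k) u ∈ lastRevealed G R J k := by
    intro z u hz j hj
    obtain ⟨hGj, hRj⟩ := h.update u (hz k hk).1 (hz j hj).1 (hz j hj).2
    obtain ⟨-, hRk⟩ := h.update u (hz k hk).1 (hz k hk).1 le_rfl
    exact ⟨hGj, hRj.trans_le ((hz j hj).2.trans_eq hRk.symm)⟩
  refine ⟨fun hz => ?_, update_mem z u⟩
  simpa only [Function.update_idem, Function.update_eq_self] using update_mem _ (z (e k)) hz

variable (μ : ∀ ε, Measure (X ε)) [∀ ε, IsProbabilityMeasure (μ ε)]

theorem integral_indicator_lastRevealed_eq_zero {f : ∀ i, X (e i) → ℝ}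
    (hf : ∀ i, Measurable (f i)) {J : Finset I} {k : I} (hk : k ∈ J)
    (hmean : ∫ u, f k u ∂μ (e k) = 0) :
    ∫ z, (lastRevealed G R J k).indicator (fun z => ∏ j ∈ J, f j (z (e j))) z
      ∂Measure.infinitePi μ = 0 := by
  classical
  set D := lastRevealed G R J k
  have hsplit : ∀ z, D.indicator (fun z => ∏ j ∈ J, f j (z (e j))) z =
      D.indicator (fun z => ∏ j ∈ J.erase k, f j (z (e j))) z * f k (z (e k)) := fun z => by
    rw [← Set.indicator_mul_const]
    simp only [Set.indicator_apply, Finset.prod_erase_mul J (fun j => f j (z (e j))) hk]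
  simp_rw [hsplit]
  rw [integral_mul_eval_infinitePi_of_update_eq μ _ (hf k), hmean, mul_zero]
  · intro z u
    simp only [Set.indicator_apply, D, h.update_mem_lastRevealed_iff hk]
    split_ifs with hz
    · refine Finset.prod_congr rfl fun j hj => ?_
      obtain ⟨hjk, hjJ⟩ := Finset.mem_erase.1 hj
      rw [Function.update_of_ne fun hjk' => hjk (h.injOn z (hz j hjJ).1 (hz k hk).1 hjk')]
    · rfl
  · exact (Finset.measurable_fun_prod _ fun j _ => (hf j).comp (measurable_pi_apply _)).indicator
      (h.measurableSet_lastRevealed J k)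

theorem integral_prod_indicator_eq_zero {f : ∀ i, X (e i) → ℝ}
    (hf : ∀ i, Measurable (f i)) (hbound : ∀ i u, |f i u| ≤ 1)
    (hmean : ∀ i, ∫ u, f i u ∂μ (e i) = 0) {J : Finset I} (hJ : J.Nonempty) :
    ∫ z, ∏ j ∈ J, (G j).indicator (fun z => f j (z (e j))) z ∂Measure.infinitePi μ = 0 := by
  have hint : Integrable (fun z => ∏ j ∈ J, f j (z (e j))) (Measure.infinitePi μ) :=
    integrable_prod_of_abs_le_one (fun j => (hf j).comp (measurable_pi_apply _))
      (fun j z => hbound j _) J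
  simp_rw [prod_indicator_eq_sum_lastRevealed h.rank_injOn hJ]
  rw [integral_finsetSum _ fun k _ => hint.indicator (h.measurableSet_lastRevealed J k)]
  exact Finset.sum_eq_zero fun k hk =>
    h.integral_indicator_lastRevealed_eq_zero μ hf hk (hmean k)

theorem map_explore :
    ((Measure.infinitePi μ).prod (Measure.infinitePi fun i => μ (e i))).map (explore e G) =
      Measure.infinitePi fun i => μ (e i) := by
  refine Measure.eq_infinitePi _ fun J a ha => ?_
  have hbox : MeasurableSet ((J : Set I).pi a) := .pi J.countable_toSet fun i _ => ha i
  rw [Measure.map_apply h.measurable_explore hbox,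
    Measure.prod_apply (h.measurable_explore hbox)]
  simp_rw [infinitePi_explore_preimage μ _ ha]
  set q : I → (∀ ε, X ε) → ℝ := fun i =>
    (G i).indicator fun z => centredIndicator (μ (e i)) (a i) (z (e i))
  have hcentred := fun i => measurable_centredIndicator (μ (e i)) (ha i)
  have hq : ∀ i, Measurable (q i) := fun i =>
    ((hcentred i).comp (measurable_pi_apply _)).indicator (h.measurableSet i)
  have hq_le : ∀ i z, |q i z| ≤ 1 := fun i z => by
    by_cases hz : z ∈ G i <;> simp [q, hz, abs_centredIndicator_le_one]
  have hprob : ∀ i z, (μ (e i)).real (a i) + q i z ∈ Set.Icc 0 1 := fun i z =>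
    measureReal_add_indicator_centredIndicator_mem_Icc _ _ _ _ _
  rw [← ofReal_integral_eq_lintegral_ofReal
      (integrable_prod_of_abs_le_one (fun i => (hq i).const_add _)
        (fun i z => abs_le.2 ⟨by linarith [(hprob i z).1], (hprob i z).2⟩) J)
      (ae_of_all _ fun z => Finset.prod_nonneg fun i _ => (hprob i z).1),
    integral_prod_const_add J _ q fun T _ => integrable_prod_of_abs_le_one hq hq_le T,
    ENNReal.ofReal_prod_of_nonneg fun _ _ => measureReal_nonneg]
  · exact Finset.prod_congr rfl fun _ _ => ofReal_measureReal
  · exact fun T _ hT => h.integral_prod_indicator_eq_zero μ hcentred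
      (fun i => abs_centredIndicator_le_one _ _) (fun i => integral_centredIndicator _ (ha i)) hT

end IsExploration

end Exploration

/-! ### Paths -/

/-- For each unordered pair of sites, a number of connections and an edge-weight. -/
abbrev EdgeMarks (d : ℕ) := (Sym2 (Site d) → ℕ) × (Sym2 (Site d) → ℝ)

theorem append_singleton_lt_append_singleton {A : Type*} [LT A] {u v : List A} (a : A)
    (hlen : u.length = v.length) (hlt : u < v) : u ++ [a] < v ++ [a] := by
  induction hlt with
  | nil => simp at hlen
  | rel h => exact .rel h
  | cons _ ih => exact .cons (ih (by simpa using hlen))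

section Paths

variable {d : ℕ} {e : Site d ↪ ℕ} {c c' : EdgeMarks d} {ε ε' : Sym2 (Site d)} {y : Site d}
  {l l' : List (Site d)}

/-- The end of the path that starts at `0` and visits the sites of the list in reverse order. All
paths from the origin are encoded by such lists, so that `y :: l` extends the path `l` by one
step. -/
def tip : List (Site d) → Site d
  | [] => 0
  | y :: _ => y

/-- All steps of the path are along connected pairs of distinct sites. -/
def IsOpen (c : EdgeMarks d) : List (Site d) → Prop
  | [] => True
  | y :: l => (1 ≤ c.1 s(tip l, y) ∧ tip l ≠ y) ∧ IsOpen c l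

/-- The length of the path. The edge-weights are only almost surely nonnegative; negative ones are
counted as `0`, so that the cost is monotone along the path for every configuration. -/
noncomputable def cost (c : EdgeMarks d) : List (Site d) → ℝ
  | [] => 0
  | y :: l => cost c l + max (c.2 s(tip l, y)) 0

/-- The key by which paths are ordered: by their length, then by their number of edges, then
lexicographically. -/
noncomputable def pathKey (e : Site d ↪ ℕ) (c : EdgeMarks d) (l : List (Site d)) :
    ℝ ×ₗ ℕ ×ₗ List ℕ :=
  toLex (cost c l, toLex (l.length, (0 :: l.reverse).map e))

/-- `l` is the first open path that reaches the pair `ε`, in the sense that it ends in one of the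
two sites of `ε`. -/
structure Leading (e : Site d ↪ ℕ) (c : EdgeMarks d) (ε : Sym2 (Site d)) (l : List (Site d)) :
    Prop where
  isOpen : IsOpen c l
  tip_mem : tip l ∈ ε
  pathKey_le : ∀ b, IsOpen c b → tip b ∈ ε → pathKey e c l ≤ pathKey e c b

theorem cost_le_cost_cons (c : EdgeMarks d) (y : Site d) (l : List (Site d)) :
    cost c l ≤ cost c (y :: l) :=
  le_add_of_nonneg_right (le_max_right _ _)

theorem cost_le_of_suffix (c : EdgeMarks d) (h : l' <:+ l) : cost c l' ≤ cost c l := by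
  induction l with
  | nil => rw [List.suffix_nil.1 h]
  | cons y l ih =>
    rcases List.suffix_cons_iff.1 h with rfl | h
    · rfl
    · exact (ih h).trans (cost_le_cost_cons c y l)

theorem pathKey_injective (e : Site d ↪ ℕ) (c : EdgeMarks d) :
    Function.Injective (pathKey e c) := by
  intro l b h
  have hsites : (0 :: l.reverse).map e = (0 :: b.reverse).map e :=
    congrArg (fun k : ℝ ×ₗ ℕ ×ₗ List ℕ => (ofLex (ofLex k).2).2) h
  simpa using List.map_injective_iff.2 e.injective hsites

theorem cost_eq_of_pathKey_eq (h : pathKey e c l = pathKey e c' l') : cost c l = cost c' l' :=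
  congrArg (fun k : ℝ ×ₗ ℕ ×ₗ List ℕ => (ofLex k).1) h

theorem pathKey_lt_pathKey_cons (e : Site d ↪ ℕ) (c : EdgeMarks d) (y : Site d)
    (l : List (Site d)) : pathKey e c l < pathKey e c (y :: l) := by
  rcases (cost_le_cost_cons c y l).lt_or_eq with h | h
  · exact Prod.Lex.toLex_lt_toLex.2 (.inl h)
  · exact Prod.Lex.toLex_lt_toLex.2 (.inr ⟨h, Prod.Lex.toLex_lt_toLex.2 (.inl (by simp))⟩)

theorem pathKey_nil_le (e : Site d ↪ ℕ) (c : EdgeMarks d) (l : List (Site d)) :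
    pathKey e c [] ≤ pathKey e c l := by
  induction l with
  | nil => rfl
  | cons y l ih => exact ih.trans (pathKey_lt_pathKey_cons e c y l).le

theorem pathKey_cons_lt_pathKey_cons (y : Site d) (htip : tip l = tip l')
    (h : pathKey e c l < pathKey e c l') : pathKey e c (y :: l) < pathKey e c (y :: l') := by
  unfold pathKey at h ⊢
  rw [Prod.Lex.toLex_lt_toLex, Prod.Lex.toLex_lt_toLex] at h ⊢
  simp only [cost, htip, List.length_cons, add_lt_add_iff_right, add_left_inj] at h ⊢
  refine h.imp_right fun ⟨hcost, h⟩ => ⟨hcost, h.imp_right fun ⟨hlen, hlex⟩ => ⟨hlen, ?_⟩⟩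
  simpa using append_singleton_lt_append_singleton (e y) (by simp [hlen]) hlex

/-- A path is only affected by changes at `ε` if it uses `ε`, and then the piece up to its first
visit of `ε` is unaffected and comes earlier. -/
theorem IsOpen.congr_or_exists_lt (e : Site d ↪ ℕ) (hcount : Set.EqOn c.1 c'.1 {ε}ᶜ)
    (hweight : Set.EqOn c.2 c'.2 {ε}ᶜ) (hl : IsOpen c l) :
    (IsOpen c' l ∧ pathKey e c' l = pathKey e c l) ∨
      ∃ b, IsOpen c b ∧ IsOpen c' b ∧ tip b ∈ ε ∧ pathKey e c' b = pathKey e c b ∧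
        pathKey e c b < pathKey e c l := by
  induction l with
  | nil => exact .inl ⟨trivial, rfl⟩
  | cons y l ih =>
    rcases ih hl.2 with ⟨hl', hkey⟩ | ⟨b, hb, hb', hbε, hkey, hlt⟩
    · by_cases hε : s(tip l, y) = ε
      · exact .inr ⟨l, hl.2, hl', hε ▸ Sym2.mem_mk_left _ _, hkey,
          pathKey_lt_pathKey_cons e c y l⟩
      · refine .inl ⟨⟨⟨hcount hε ▸ hl.1.1, hl.1.2⟩, hl'⟩, ?_⟩
        simp only [pathKey, cost, cost_eq_of_pathKey_eq hkey, hweight hε]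
    · exact .inr ⟨b, hb, hb', hbε, hkey, hlt.trans (pathKey_lt_pathKey_cons e c y l)⟩

theorem Leading.congr (hl : Leading e c ε l) (hl' : Leading e c ε' l')
    (hle : pathKey e c l' ≤ pathKey e c l) (hcount : Set.EqOn c.1 c'.1 {ε}ᶜ)
    (hweight : Set.EqOn c.2 c'.2 {ε}ᶜ) :
    Leading e c' ε' l' ∧ pathKey e c' l' = pathKey e c l' := by
  obtain ⟨hopen, hkey⟩ := (hl'.isOpen.congr_or_exists_lt e hcount hweight).resolve_right
    fun ⟨b, hb, _, hbε, _, hlt⟩ => (hl.pathKey_le b hb hbε).not_gt (hlt.trans_le hle)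
  refine ⟨⟨hopen, hl'.tip_mem, fun b hb hbε' => ?_⟩, hkey⟩
  rw [hkey]
  rcases hb.congr_or_exists_lt e hcount.symm hweight.symm with
    ⟨hb', hbkey⟩ | ⟨b', -, hb', hb'ε, hb'key, hlt⟩
  · exact hbkey ▸ hl'.pathKey_le b hb' hbε'
  · exact hle.trans ((hl.pathKey_le b' hb' hb'ε).trans (hb'key ▸ hlt.le))

theorem Leading.unique (hl : Leading e c ε l) (hl' : Leading e c ε l') : l = l' :=
  pathKey_injective e c <|
    (hl.pathKey_le l' hl'.isOpen hl'.tip_mem).antisymm (hl'.pathKey_le l hl.isOpen hl.tip_mem)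

theorem measurableSet_isOpen (l : List (Site d)) :
    MeasurableSet {c : EdgeMarks d | IsOpen c l} := by
  induction l with
  | nil => exact .const True
  | cons y l ih =>
    refine .inter (.inter ?_ (.const _)) ih
    exact measurableSet_le (f := fun _ : EdgeMarks d => 1) (g := fun c => c.1 s(tip l, y))
      measurable_const (by fun_prop)

theorem measurable_cost (l : List (Site d)) : Measurable fun c : EdgeMarks d => cost c l := by
  induction l with
  | nil => exact measurable_const
  | cons y l ih => exact ih.add (.max (by fun_prop) measurable_const)

theorem measurableSet_pathKey_le (e : Site d ↪ ℕ) (l b : List (Site d)) :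
    MeasurableSet {c : EdgeMarks d | pathKey e c l ≤ pathKey e c b} := by
  simp only [pathKey, Prod.Lex.toLex_le_toLex (x := (_ : ℝ × _))]
  exact (measurableSet_lt (measurable_cost l) (measurable_cost b)).union
    ((measurableSet_eq_fun (measurable_cost l) (measurable_cost b)).inter (.const _))

theorem measurableSet_leading (e : Site d ↪ ℕ) (ε : Sym2 (Site d)) (l : List (Site d)) :
    MeasurableSet {c : EdgeMarks d | Leading e c ε l} := by
  have heq : {c : EdgeMarks d | Leading e c ε l} = {c | IsOpen c l} ∩ ({_c | tip l ∈ ε} ∩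
      ⋂ b, {c | IsOpen c b → tip b ∈ ε → pathKey e c l ≤ pathKey e c b}) := by
    ext c
    simp only [Set.mem_inter_iff, Set.mem_iInter]
    exact ⟨fun ⟨h, hε, hle⟩ => ⟨h, hε, hle⟩, fun ⟨h, hε, hle⟩ => ⟨h, hε, hle⟩⟩
  rw [heq]
  exact (measurableSet_isOpen l).inter <| .inter (.const _) <| .iInter fun b =>
    (measurableSet_isOpen b).imp <| .imp (.const _) (measurableSet_pathKey_le e l b)

end Paths

/-! ### Exploring the percolation by the branching random walk -/

section ExploredBRW

variable {d : ℕ}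

/-- The individual whose ancestors are located at the sites of the list and have number `0`. -/
def toIndiv (l : List (Site d)) : Indiv d := l.map fun y => (y, 0)

theorem map_fst_toIndiv (l : List (Site d)) : (toIndiv l).map Prod.fst = l := by
  simp [toIndiv, Function.comp_def]

theorem site_toIndiv : ∀ l : List (Site d), Indiv.site (toIndiv l) = tip l
  | [] => rfl
  | _ :: _ => rfl

/-- The pair of the locations of an individual and of her children at a given site. -/
def offspringEdge (i : Indiv d × Site d) : Sym2 (Site d) := s(Indiv.site i.1, i.2)

/-- The pair of the locations of an individual and of her parent, where the root counts as her own
parent. -/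
def parentEdge (b : Indiv d) : Sym2 (Site d) := s(Indiv.site b.tail, Indiv.site b)

/-- The coordinates of a branching random walk that are read off the marks of the percolation: the
number of children at `y` of the number-`0` individual that follows the path `l`, and the
edge-weight of the first of these children, provided that `l` is the first open path that reaches
the pair formed by its end and `y`. -/
def revealed (e : Site d ↪ ℕ) (i : (Indiv d × Site d) ⊕ Indiv d) : Set (EdgeMarks d) :=
  {c | ∃ l y, (i = .inl (toIndiv l, y) ∨ i = .inr (toIndiv (y :: l))) ∧
    Leading e c s(tip l, y) l}

/-- The locations of the ancestors of the individual whose offspring is described by the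
coordinate, including her own. -/
def parentPath : (Indiv d × Site d) ⊕ Indiv d → List (Site d)
  | .inl (a, _) => a.map Prod.fst
  | .inr b => b.tail.map Prod.fst

/-- The order in which the coordinates are revealed; the encoding breaks ties between the
coordinates that belong to the same path. -/
noncomputable def rank (e : Site d ↪ ℕ) (c : EdgeMarks d) (i : (Indiv d × Site d) ⊕ Indiv d) :
    (ℝ ×ₗ ℕ ×ₗ List ℕ) ×ₗ ℕ :=
  toLex (pathKey e c (parentPath i), Encodable.encode i)

open Classical in
/-- The branching random walk whose revealed coordinates are those of the percolation `p.1`, the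
others being those of the branching random walk `p.2`. -/
noncomputable def exploredBRW (e : Site d ↪ ℕ) (p : EdgeMarks d × BRWConf d) : BRWConf d :=
  (fun i => if p.1 ∈ revealed e (.inl i) then p.1.1 (offspringEdge i) else p.2.1 i,
    fun b => if p.1 ∈ revealed e (.inr b) then p.1.2 (parentEdge b) else p.2.2 b)

variable {e : Site d ↪ ℕ} {c : EdgeMarks d} {i : (Indiv d × Site d) ⊕ Indiv d}

theorem leading_of_mem_revealed (h : c ∈ revealed e i) :
    Leading e c (Sum.elim offspringEdge parentEdge i) (parentPath i) := by
  obtain ⟨l, y, rfl | rfl, hl⟩ := h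
  · simpa [offspringEdge, parentPath, site_toIndiv, map_fst_toIndiv] using hl
  · have htail : (toIndiv (y :: l)).tail = toIndiv l := rfl
    simpa [parentEdge, parentPath, htail, site_toIndiv, map_fst_toIndiv, tip] using hl

theorem measurableSet_revealed (e : Site d ↪ ℕ) (i : (Indiv d × Site d) ⊕ Indiv d) :
    MeasurableSet (revealed e i) := by
  simp only [revealed, Set.ofPred_exists]
  exact .iUnion fun l => .iUnion fun y => .inter (.const _) (measurableSet_leading e _ l)

theorem measurableSet_rank_le (e : Site d ↪ ℕ) (i j : (Indiv d × Site d) ⊕ Indiv d) :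
    MeasurableSet {c | rank e c i ≤ rank e c j} := by
  simp only [rank, Prod.Lex.toLex_le_toLex (x := (_ : (ℝ ×ₗ ℕ ×ₗ List ℕ) × ℕ)),
    lt_iff_le_not_ge, le_antisymm_iff (a := pathKey e _ _)]
  have hle := fun i j => measurableSet_pathKey_le e (parentPath i) (parentPath (d := d) j)
  exact ((hle i j).inter (hle j i).compl).union (((hle i j).inter (hle j i)).inter (.const _))

theorem rank_injective (e : Site d ↪ ℕ) (c : EdgeMarks d) : Function.Injective (rank e c) :=
  fun _ _ h => Encodable.encode_injective (congrArg (fun k => (ofLex k).2) h)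

theorem mem_revealed_congr {c' : EdgeMarks d} {j : (Indiv d × Site d) ⊕ Indiv d}
    (hi : c ∈ revealed e i) (hj : c ∈ revealed e j) (hle : rank e c j ≤ rank e c i)
    (hcount : Set.EqOn c.1 c'.1 {Sum.elim offspringEdge parentEdge i}ᶜ)
    (hweight : Set.EqOn c.2 c'.2 {Sum.elim offspringEdge parentEdge i}ᶜ) :
    c' ∈ revealed e j ∧ rank e c' j = rank e c j := by
  have hkey : pathKey e c (parentPath j) ≤ pathKey e c (parentPath i) :=
    Prod.Lex.monotone_fst _ _ hle
  have hi' := leading_of_mem_revealed hi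
  refine ⟨?_, ?_⟩
  · obtain ⟨l, y, hjl, hl⟩ := hj
    have hpath : parentPath j = l := by
      rcases hjl with rfl | rfl
      exacts [map_fst_toIndiv l, map_fst_toIndiv l]
    exact ⟨l, y, hjl, (hi'.congr hl (hpath ▸ hkey) hcount hweight).1⟩
  · rw [rank, (hi'.congr (leading_of_mem_revealed hj) hkey hcount hweight).2, rank]

theorem injOn_offspringEdge_parentEdge (e : Site d ↪ ℕ) (c : EdgeMarks d) :
    Set.InjOn (Sum.map offspringEdge parentEdge) {i | c ∈ revealed e i} := by
  have next_eq : ∀ {l l' y y'}, Leading e c s(tip l, y) l → Leading e c s(tip l', y') l' →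
      s(tip l, y) = s(tip l', y') → l = l' ∧ y = y' := by
    intro l l' y y' hl hl' h
    obtain rfl : l = l' := (h ▸ hl).unique hl'
    exact ⟨rfl, Sym2.congr_right.1 h⟩
  have parentEdge_cons : ∀ (l : List (Site d)) (y : Site d),
      parentEdge (toIndiv (y :: l)) = s(tip l, y) :=
    fun l y => congrArg (s(·, y)) (site_toIndiv l)
  rintro _ ⟨l, y, rfl | rfl, hl⟩ _ ⟨l', y', rfl | rfl, hl'⟩ h <;>
    simp only [Sum.map_inl, Sum.map_inr, reduceCtorEq, Sum.inl.injEq, Sum.inr.injEq,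
      offspringEdge, parentEdge_cons, site_toIndiv] at h
  · obtain ⟨rfl, rfl⟩ := next_eq hl hl' h
    rfl
  · obtain ⟨rfl, rfl⟩ := next_eq hl hl' h
    rfl

/-- The two families of marks in `EdgeMarks` as one family, indexed by two copies of the set of
unordered pairs of sites. -/
abbrev Mark (d : ℕ) : Sym2 (Site d) ⊕ Sym2 (Site d) → Type :=
  Sum.elim (fun _ => ℕ) fun _ => ℝ

instance : ∀ ε, MeasurableSpace (Mark d ε) :=
  Sum.rec (fun _ => inferInstanceAs (MeasurableSpace ℕ))
    fun _ => inferInstanceAs (MeasurableSpace ℝ)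

theorem isExploration_revealed (e : Site d ↪ ℕ) :
    IsExploration (X := Mark d) (Sum.map offspringEdge parentEdge)
      (fun i => MeasurableEquiv.sumPiEquivProdPi (Mark d) ⁻¹' revealed e i)
      (fun z => rank e (MeasurableEquiv.sumPiEquivProdPi (Mark d) z)) where
  measurableSet i := MeasurableEquiv.measurable _ (measurableSet_revealed e i)
  measurableSet_rank_le i j := MeasurableEquiv.measurable _ (measurableSet_rank_le e i j)
  rank_injOn _ := (rank_injective e _).injOn
  injOn z := injOn_offspringEdge_parentEdge e (MeasurableEquiv.sumPiEquivProdPi (Mark d) z)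
  update z i j u hi hj hle := by
    refine mem_revealed_congr hi hj hle (fun ε hε => ?_) fun ε hε => ?_ <;>
      refine (Function.update_of_ne (fun h => ?_) u z).symm <;>
      rcases i with i | i <;> simp_all

instance (μ : Site d → Site d → Measure ℕ) [∀ x y, IsProbabilityMeasure (μ x y)] (ρ : Measure ℝ)
    [IsProbabilityMeasure ρ] : IsProbabilityMeasure (brwLaw μ ρ) := by
  unfold brwLaw
  infer_instance

/-- The joint law of the marks of the percolation, with numbers of connections of laws `μ ε` and
edge-weights of law `ρ`, and of an independent branching random walk in which an individual at `x`
has as many children at `y` as there are connections of `x` and `y`, in law. -/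
noncomputable def sampleLaw (μ : Sym2 (Site d) → Measure ℕ) (ρ : Measure ℝ) :
    Measure (EdgeMarks d × BRWConf d) :=
  ((Measure.infinitePi μ).prod (Measure.infinitePi fun _ => ρ)).prod
    (brwLaw (fun x y => μ s(x, y)) ρ)

variable (μ : Sym2 (Site d) → Measure ℕ) [∀ ε, IsProbabilityMeasure (μ ε)] (ρ : Measure ℝ)
  [IsProbabilityMeasure ρ]

instance : IsProbabilityMeasure (sampleLaw μ ρ) := by
  unfold sampleLaw
  infer_instance

theorem measurePreserving_exploredBRW (e : Site d ↪ ℕ) :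
    MeasurePreserving (exploredBRW e) (sampleLaw μ ρ) (brwLaw (fun x y => μ s(x, y)) ρ) := by
  let m : ∀ ε, Measure (Mark d ε)
    | .inl ε => μ ε
    | .inr _ => ρ
  have hm : ∀ ε, IsProbabilityMeasure (m ε) := by
    rintro (ε | ε)
    exacts [inferInstanceAs (IsProbabilityMeasure (μ ε)), inferInstanceAs (IsProbabilityMeasure ρ)]
  have hmarks : MeasurePreserving (α := EdgeMarks d)
      (MeasurableEquiv.sumPiEquivProdPi (Mark d)).symm
      ((Measure.infinitePi μ).prod (Measure.infinitePi fun _ => ρ)) (Measure.infinitePi m) :=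
    (measurePreserving_sumPiEquivProdPi_infinitePi m).symm _
  have hcoords : MeasurePreserving (β := BRWConf d)
      (MeasurableEquiv.sumPiEquivProdPi fun i => Mark d (Sum.map offspringEdge parentEdge i))
      (Measure.infinitePi fun i => m (Sum.map offspringEdge parentEdge i))
      (brwLaw (fun x y => μ s(x, y)) ρ) :=
    measurePreserving_sumPiEquivProdPi_infinitePi
      fun i => m (Sum.map (offspringEdge (d := d)) parentEdge i)
  have hcoords_symm : MeasurePreserving (α := BRWConf d)
      (MeasurableEquiv.sumPiEquivProdPi fun i => Mark d (Sum.map offspringEdge parentEdge i)).symm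
      (brwLaw (fun x y => μ s(x, y)) ρ)
      (Measure.infinitePi fun i => m (Sum.map offspringEdge parentEdge i)) :=
    hcoords.symm _
  have hexplore := isExploration_revealed e
  exact (hcoords.comp ⟨hexplore.measurable_explore, hexplore.map_explore m⟩).comp
    (hmarks.prod hcoords_symm)

end ExploredBRW

/-! ### Walks of the percolation graph -/

section Walks

variable {d : ℕ} {e : Site d ↪ ℕ} {s : EdgeConf d} {c : EdgeMarks d} {x y z : Site d}
  {l : List (Site d)}

/-- The key of a walk, which orders the walks between two sites in the way in which `IsTreePath`
breaks ties. -/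
noncomputable def walkKey (e : Site d ↪ ℕ) (p : (sfpGraph s).Walk x y) : ℝ ×ₗ ℕ ×ₗ List ℕ :=
  toLex (lLength s p, toLex (p.length, p.support.map e))

theorem lLength_bypass_le [DecidableEq (Site d)] (hs : ∀ ε, 0 ≤ s.2 ε)
    (p : (sfpGraph s).Walk x y) : lLength s p.bypass ≤ lLength s p := by
  refine (p.edges_bypass_sublist_edges.map s.2).sum_le_sum fun r hr => ?_
  obtain ⟨ε, -, rfl⟩ := List.mem_map.1 hr
  exact hs ε

theorem IsTreePath.walkKey_le {p : (sfpGraph s).Walk x y} (hp : IsTreePath e s p)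
    (hs : ∀ ε, 0 ≤ s.2 ε) (q : (sfpGraph s).Walk x y) : walkKey e p ≤ walkKey e q := by
  classical
  have hbypass := lLength_bypass_le hs q
  have hle := (hp.1.2 _ q.bypass_isPath).trans hbypass
  simp only [walkKey, Prod.Lex.toLex_le_toLex]
  refine hle.lt_or_eq.imp_right fun heq => ⟨heq, ?_⟩
  have hshort : IsShortest s q.bypass :=
    ⟨q.bypass_isPath, fun r hr => (hbypass.trans heq.ge).trans (hp.1.2 r hr)⟩
  rcases hp.2 _ hshort with hlt | ⟨hlen, hlex⟩
  · exact .inl (hlt.trans_le q.length_bypass_le_length)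
  · rcases q.length_bypass_le_length.lt_or_eq with hlt | heq'
    · exact .inl (hlen ▸ hlt)
    · rw [q.bypass_eq_self_of_length_le_length_bypass heq'.ge] at hlen hlex
      exact .inr ⟨hlen, hlex⟩

/-- The percolation configuration in which the connected pairs form the edges. -/
def toEdgeConf (c : EdgeMarks d) : EdgeConf d :=
  (fun ε => decide (1 ≤ c.1 ε), c.2)

theorem toEdgeConf_adj : (sfpGraph (toEdgeConf c)).Adj x y ↔ 1 ≤ c.1 s(x, y) ∧ x ≠ y := by
  simp [sfpGraph, toEdgeConf]

theorem lLength_concat (p : (sfpGraph s).Walk x y) (h : (sfpGraph s).Adj y z) :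
    lLength s (p.concat h) = lLength s p + s.2 s(y, z) := by
  simp [lLength, SimpleGraph.Walk.edges_concat]

theorem exists_isOpen_of_walk (hc : ∀ ε, 0 ≤ c.2 ε) (p : (sfpGraph (toEdgeConf c)).Walk 0 z) :
    ∃ l, IsOpen c l ∧ tip l = z ∧ p.support = 0 :: l.reverse ∧ lLength _ p = cost c l := by
  generalize h0 : (0 : Site d) = x at p
  induction p using SimpleGraph.Walk.concatRec with
  | Hnil => exact ⟨[], trivial, h0, rfl, rfl⟩
  | @Hconcat x y z p h ih =>
    obtain ⟨l, hl, rfl, hsupp, hlen⟩ := ih h0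
    refine ⟨z :: l, ⟨toEdgeConf_adj.1 h, hl⟩, rfl, ?_, ?_⟩
    · simp [SimpleGraph.Walk.support_concat, hsupp]
    · rw [lLength_concat, hlen, cost, max_eq_left (hc _)]
      rfl

theorem IsOpen.exists_walk (hc : ∀ ε, 0 ≤ c.2 ε) (hl : IsOpen c l) :
    ∃ p : (sfpGraph (toEdgeConf c)).Walk 0 (tip l),
      p.support = 0 :: l.reverse ∧ lLength _ p = cost c l := by
  induction l with
  | nil => exact ⟨.nil, rfl, rfl⟩
  | cons y l ih =>
    obtain ⟨p, hsupp, hlen⟩ := ih hl.2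
    refine ⟨p.concat (toEdgeConf_adj.2 hl.1), ?_, ?_⟩
    · rw [SimpleGraph.Walk.support_concat, hsupp, List.reverse_cons]
      rfl
    · rw [lLength_concat, hlen, cost, max_eq_left (hc _)]
      rfl

theorem walkKey_eq_pathKey {p : (sfpGraph (toEdgeConf c)).Walk x z}
    (hsupp : p.support = 0 :: l.reverse) (hlen : lLength _ p = cost c l) :
    walkKey e p = pathKey e c l := by
  have hlength : p.length = l.length := by
    simpa [p.length_support] using congrArg List.length hsupp
  rw [walkKey, pathKey, hlen, hlength, hsupp]

end Walks

/-! ### Minimal paths -/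

section MinimalPaths

variable {d : ℕ} {e : Site d ↪ ℕ} {c : EdgeMarks d} {x y z : Site d} {l l' : List (Site d)}

/-- `l` is the first open path to its end in the order of the path keys. -/
structure IsMinimal (e : Site d ↪ ℕ) (c : EdgeMarks d) (l : List (Site d)) : Prop where
  isOpen : IsOpen c l
  pathKey_le : ∀ b, IsOpen c b → tip b = tip l → pathKey e c l ≤ pathKey e c b

theorem isMinimal_nil (e : Site d ↪ ℕ) (c : EdgeMarks d) : IsMinimal e c [] :=
  ⟨trivial, fun b _ _ => pathKey_nil_le e c b⟩

theorem IsMinimal.of_cons (h : IsMinimal e c (y :: l)) : IsMinimal e c l where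
  isOpen := h.isOpen.2
  pathKey_le b hb htip := by
    by_contra! hlt
    exact (pathKey_cons_lt_pathKey_cons y htip hlt).not_ge
      (h.pathKey_le (y :: b) ⟨htip ▸ h.isOpen.1, hb⟩ rfl)

theorem IsMinimal.of_suffix (h : IsMinimal e c l) (hl : l' <:+ l) : IsMinimal e c l' := by
  induction l with
  | nil => rwa [List.suffix_nil.1 hl]
  | cons y l ih =>
    rcases List.suffix_cons_iff.1 hl with rfl | hl
    · exact h
    · exact ih h.of_cons hl

theorem IsMinimal.leading (h : IsMinimal e c (y :: l)) : Leading e c s(tip l, y) l where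
  isOpen := h.isOpen.2
  tip_mem := Sym2.mem_mk_left _ _
  pathKey_le b hb htip := by
    rcases Sym2.mem_iff.1 htip with htip | htip
    · exact h.of_cons.pathKey_le b hb htip
    · exact (pathKey_lt_pathKey_cons e c y l).le.trans (h.pathKey_le b hb htip)

theorem IsMinimal.unique (h : IsMinimal e c l) (h' : IsMinimal e c l') (htip : tip l = tip l') :
    l = l' :=
  pathKey_injective e c <|
    (h.pathKey_le l' h'.isOpen htip.symm).antisymm (h'.pathKey_le l h.isOpen htip)

theorem IsTreePath.exists_isMinimal {p : (sfpGraph (toEdgeConf c)).Walk 0 z}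
    (hp : IsTreePath e _ p) (hc : ∀ ε, 0 ≤ c.2 ε) :
    ∃ l, IsMinimal e c l ∧ p.support = 0 :: l.reverse ∧ lLength _ p = cost c l := by
  obtain ⟨l, hl, rfl, hsupp, hlen⟩ := exists_isOpen_of_walk hc p
  refine ⟨l, ⟨hl, fun b hb htip => ?_⟩, hsupp, hlen⟩
  obtain ⟨q, hqsupp, hqlen⟩ := hb.exists_walk hc
  rw [← walkKey_eq_pathKey hsupp hlen, ← walkKey_eq_pathKey hqsupp hqlen]
  generalize tip b = z at q htip
  subst htip
  exact hp.walkKey_le hc q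

theorem exists_suffix_tip_eq (hx : x ∈ l ++ [0]) : ∃ l', l' <:+ l ∧ tip l' = x := by
  induction l with
  | nil => exact ⟨[], List.suffix_rfl, (List.mem_singleton.1 hx).symm⟩
  | cons z l ih =>
    rcases List.mem_cons.1 hx with rfl | hx
    · exact ⟨x :: l, List.suffix_rfl, rfl⟩
    · obtain ⟨l', hl', htip⟩ := ih hx
      exact ⟨l', hl'.trans (List.suffix_cons z l), htip⟩

theorem tip_eq_of_singleton_prefix (hx : [x] <+: l ++ [0]) : tip l = x := by
  cases l <;> exact (List.cons_prefix_cons.1 hx).1.symm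

theorem exists_cons_suffix_tip_eq (hyx : [y, x] <:+: l ++ [0]) :
    ∃ l', y :: l' <:+ l ∧ tip l' = x := by
  induction l with
  | nil => simpa using hyx.length_le
  | cons z l ih =>
    rcases List.infix_cons_iff.1 hyx with hyx | hyx
    · obtain ⟨rfl, hx⟩ := List.cons_prefix_cons.1 hyx
      exact ⟨l, List.suffix_rfl, tip_eq_of_singleton_prefix hx⟩
    · obtain ⟨l', hl', htip⟩ := ih hyx
      exact ⟨l', hl'.trans (List.suffix_cons z l), htip⟩

theorem IsTreePath.exists_isMinimal_of_mem_support {p : (sfpGraph (toEdgeConf c)).Walk 0 z}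
    (hp : IsTreePath e _ p) (hc : ∀ ε, 0 ≤ c.2 ε) (hx : x ∈ p.support) :
    ∃ l, IsMinimal e c l ∧ tip l = x ∧ cost c l ≤ lLength _ p := by
  obtain ⟨l, hl, hsupp, hlen⟩ := hp.exists_isMinimal hc
  obtain ⟨l', hl', htip⟩ :=
    exists_suffix_tip_eq (l := l) (x := x) (by simpa [hsupp, or_comm] using hx)
  exact ⟨l', hl.of_suffix hl', htip, hlen ▸ cost_le_of_suffix c hl'⟩

theorem IsTreePath.exists_isMinimal_of_mem_darts {p : (sfpGraph (toEdgeConf c)).Walk 0 z}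
    (hp : IsTreePath e _ p) (hc : ∀ ε, 0 ≤ c.2 ε)
    (hxy : (x, y) ∈ p.darts.map SimpleGraph.Dart.toProd) :
    ∃ l, IsMinimal e c (y :: l) ∧ tip l = x ∧ cost c (y :: l) ≤ lLength _ p := by
  obtain ⟨l, hl, hsupp, hlen⟩ := hp.exists_isMinimal hc
  obtain ⟨δ, hδ, hδxy⟩ := List.mem_map.1 hxy
  have hinfix := SimpleGraph.Walk.mem_darts_iff_fst_snd_infix_support.1 hδ
  rw [hsupp, congrArg Prod.fst hδxy, congrArg Prod.snd hδxy] at hinfix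
  obtain ⟨l', hl', htip⟩ := exists_cons_suffix_tip_eq (by simpa using List.reverse_infix.2 hinfix)
  exact ⟨l', hl.of_suffix hl', htip, hlen ▸ cost_le_of_suffix c hl'⟩

end MinimalPaths

/-! ### The embedding of the shortest-path tree -/

section Embedding

variable {d : ℕ} {e : Site d ↪ ℕ} {c : EdgeMarks d} {x y : Site d} {l : List (Site d)} {t : ℝ}

/-- The branching random walk in which every individual keeps one child at every site at which she
has at least one. -/
def thin (p : BRWConf d) : BRWConf d :=
  (fun i => min 1 (p.1 i), p.2)

theorem isThinning_thin (p : BRWConf d) : IsThinning (thin p) p :=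
  ⟨fun _ _ _ => rfl, fun _ _ => rfl⟩

theorem born_of_born_thin {p : BRWConf d} : ∀ {a : Indiv d}, Born (thin p) a → Born p a
  | [], _ => trivial
  | (_, _) :: _, h => ⟨h.1.trans_le (min_le_right _ _), born_of_born_thin h.2⟩

theorem rootDist_thin (p : BRWConf d) : ∀ a : Indiv d, rootDist (thin p) a = rootDist p a
  | [] => rfl
  | b :: a => congrArg (· + p.2 (b :: a)) (rootDist_thin p a)

theorem brwBall_thin_verts_subset (w : Env d) (p : BRWConf d) (t : ℝ) :
    (brwBall w (thin p) t).verts ⊆ (brwBall w p t).verts :=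
  fun a ha => ⟨born_of_born_thin ha.1, rootDist_thin p a ▸ ha.2⟩

theorem brwBall_thin_isSubgraphVia (w : Env d) (p : BRWConf d) (t : ℝ) :
    (brwBall w (thin p) t).IsSubgraphVia id (brwBall w p t) where
  map_root := rfl
  mapsTo := brwBall_thin_verts_subset w p t
  injOn := Function.injective_id.injOn
  map_loc _ _ := rfl
  map_vertexWeight _ _ := rfl
  map_edge _ _ h :=
    ⟨brwBall_thin_verts_subset w p t h.1, brwBall_thin_verts_subset w p t h.2.1, h.2.2⟩
  map_edgeWeight _ _ _ := rfl

theorem exploredBRW_fst_of_isMinimal (f : BRWConf d) (h : IsMinimal e c (y :: l)) :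
    (exploredBRW e (c, f)).1 (toIndiv l, y) = c.1 s(tip l, y) :=
  (if_pos ⟨l, y, .inl rfl, h.leading⟩).trans <| congrArg (c.1 s(·, y)) (site_toIndiv l)

theorem exploredBRW_snd_of_isMinimal (f : BRWConf d) (h : IsMinimal e c (y :: l)) :
    (exploredBRW e (c, f)).2 (toIndiv (y :: l)) = c.2 s(tip l, y) :=
  (if_pos ⟨l, y, .inr rfl, h.leading⟩).trans <| congrArg (c.2 s(·, y)) (site_toIndiv l)

theorem IsMinimal.born (f : BRWConf d) (h : IsMinimal e c l) :
    Born (thin (exploredBRW e (c, f))) (toIndiv l) := by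
  induction l with
  | nil => trivial
  | cons y l ih =>
    refine ⟨lt_min one_pos ?_, ih h.of_cons⟩
    exact (Nat.succ_le_iff.1 h.isOpen.1.1).trans_eq (exploredBRW_fst_of_isMinimal f h).symm

theorem IsMinimal.rootDist_eq (f : BRWConf d) (hc : ∀ ε, 0 ≤ c.2 ε) (h : IsMinimal e c l) :
    rootDist (thin (exploredBRW e (c, f))) (toIndiv l) = cost c l := by
  induction l with
  | nil => rfl
  | cons y l ih =>
    rw [cost, max_eq_left (hc _), ← ih h.of_cons, ← exploredBRW_snd_of_isMinimal f h]
    rfl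

theorem IsMinimal.toIndiv_mem_brwBall (w : Env d) (f : BRWConf d) (hc : ∀ ε, 0 ≤ c.2 ε)
    (h : IsMinimal e c l) (ht : cost c l ≤ t) :
    toIndiv l ∈ (brwBall w (thin (exploredBRW e (c, f))) t).verts :=
  ⟨h.born f, (h.rootDist_eq f hc).trans_le ht⟩

open Classical in
/-- The individual that represents a site of the shortest-path tree: the one that follows the
minimal path to the site. Sites without a minimal path are sent to the root. -/
noncomputable def embedding (e : Site d ↪ ℕ) (c : EdgeMarks d) (x : Site d) : Indiv d :=
  if h : ∃ l, IsMinimal e c l ∧ tip l = x then toIndiv h.choose else []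

theorem IsMinimal.embedding_tip (h : IsMinimal e c l) : embedding e c (tip l) = toIndiv l := by
  have hex : ∃ l', IsMinimal e c l' ∧ tip l' = tip l := ⟨l, h, rfl⟩
  rw [embedding, dif_pos hex, hex.choose_spec.1.unique h hex.choose_spec.2]

theorem exists_isMinimal_of_mem_verts {w : Env d} (hc : ∀ ε, 0 ≤ c.2 ε)
    (hx : x ∈ (shortestPathTree e w (toEdgeConf c) t).verts) :
    ∃ l, IsMinimal e c l ∧ tip l = x ∧ cost c l ≤ t := by
  obtain ⟨z, p, hp, hpt, hx⟩ := hx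
  obtain ⟨l, hl, htip, hlt⟩ := hp.exists_isMinimal_of_mem_support hc hx
  exact ⟨l, hl, htip, hlt.trans hpt⟩

theorem exists_isMinimal_of_edge {w : Env d} (hc : ∀ ε, 0 ≤ c.2 ε)
    (hxy : (shortestPathTree e w (toEdgeConf c) t).edge x y) :
    ∃ l, IsMinimal e c (y :: l) ∧ tip l = x ∧ cost c (y :: l) ≤ t := by
  obtain ⟨z, p, hp, hpt, hxy⟩ := hxy
  obtain ⟨l, hl, htip, hlt⟩ := hp.exists_isMinimal_of_mem_darts hc hxy
  exact ⟨l, hl, htip, hlt.trans hpt⟩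

theorem site_embedding {w : Env d} (hc : ∀ ε, 0 ≤ c.2 ε)
    (hx : x ∈ (shortestPathTree e w (toEdgeConf c) t).verts) :
    Indiv.site (embedding e c x) = x := by
  obtain ⟨l, hl, rfl, -⟩ := exists_isMinimal_of_mem_verts hc hx
  rw [hl.embedding_tip, site_toIndiv]

theorem shortestPathTree_isSubgraphVia (e : Site d ↪ ℕ) (w : Env d) (f : BRWConf d)
    (hc : ∀ ε, 0 ≤ c.2 ε) (t : ℝ) :
    (shortestPathTree e w (toEdgeConf c) t).IsSubgraphVia (embedding e c)
      (brwBall w (thin (exploredBRW e (c, f))) t) where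
  map_root := (isMinimal_nil e c).embedding_tip
  mapsTo x hx := by
    obtain ⟨l, hl, rfl, ht⟩ := exists_isMinimal_of_mem_verts hc hx
    exact hl.embedding_tip ▸ hl.toIndiv_mem_brwBall w f hc ht
  injOn x hx y hy hxy := by
    rw [← site_embedding hc hx, hxy, site_embedding hc hy]
  map_loc _ hx := site_embedding hc hx
  map_vertexWeight _ hx := congrArg w (site_embedding hc hx)
  map_edge x y hxy := by
    obtain ⟨l, hl, rfl, ht⟩ := exists_isMinimal_of_edge hc hxy
    have hy : embedding e c y = toIndiv (y :: l) := hl.embedding_tip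
    rw [hl.of_cons.embedding_tip, hy]
    exact ⟨hl.of_cons.toIndiv_mem_brwBall w f hc ((cost_le_cost_cons c y l).trans ht),
      hl.toIndiv_mem_brwBall w f hc ht, (y, 0), rfl⟩
  map_edgeWeight x y hxy := by
    obtain ⟨l, hl, rfl, -⟩ := exists_isMinimal_of_edge hc hxy
    have hy : embedding e c y = toIndiv (y :: l) := hl.embedding_tip
    rw [hy]
    exact exploredBRW_snd_of_isMinimal f hl

end Embedding

/-! ### Laws in the environment -/

section Laws

variable {d : ℕ}

theorem measurePreserving_toEdgeConf_sampleLaw (μ : Sym2 (Site d) → Measure ℕ)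
    [∀ ε, IsProbabilityMeasure (μ ε)] (ρ : Measure ℝ) [IsProbabilityMeasure ρ] :
    MeasurePreserving (fun p : EdgeMarks d × BRWConf d => toEdgeConf p.1) (sampleLaw μ ρ)
      ((Measure.infinitePi fun ε => (μ ε).map fun n => decide (1 ≤ n)).prod
        (Measure.infinitePi fun _ => ρ)) := by
  have : ∀ ε, IsProbabilityMeasure ((μ ε).map fun n => decide (1 ≤ n)) :=
    fun ε => Measure.isProbabilityMeasure_map Measurable.of_discrete.aemeasurable
  exact ((measurePreserving_map_infinitePi μ (f := fun _ n => decide (1 ≤ n))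
    fun _ => .of_discrete).prod (.id _)).comp measurePreserving_fst

theorem measurePreserving_thin (μ : Site d → Site d → Measure ℕ)
    [∀ x y, IsProbabilityMeasure (μ x y)] (ρ : Measure ℝ) [IsProbabilityMeasure ρ] :
    MeasurePreserving thin (brwLaw μ ρ) (brwLaw (fun x y => (μ x y).map (min 1)) ρ) := by
  have : ∀ x y, IsProbabilityMeasure ((μ x y).map (min 1)) :=
    fun x y => Measure.isProbabilityMeasure_map Measurable.of_discrete.aemeasurable
  exact (measurePreserving_map_infinitePi (fun i : Indiv d × Site d => μ (Indiv.site i.1) i.2)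
    (f := fun _ => min 1) fun _ => .of_discrete).prod (.id _)

theorem ae_nonneg_sampleLaw (μ : Sym2 (Site d) → Measure ℕ) [∀ ε, IsProbabilityMeasure (μ ε)]
    (ρ : Measure ℝ) [IsProbabilityMeasure ρ] (hρ : ∀ᵐ l ∂ρ, 0 ≤ l) :
    ∀ᵐ p ∂sampleLaw μ ρ, ∀ ε, 0 ≤ p.1.2 ε := by
  refine ae_all_iff.2 fun ε => ?_
  have heval : MeasurePreserving (fun p : EdgeMarks d × BRWConf d => p.1.2 ε)
      (sampleLaw μ ρ) ρ :=
    (measurePreserving_eval_infinitePi (fun _ : Sym2 (Site d) => ρ) ε).comp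
      (measurePreserving_snd.comp measurePreserving_fst)
  exact heval.quasiMeasurePreserving.ae hρ

theorem measurable_measure_prod {Θ A B : Type*} [MeasurableSpace Θ] [MeasurableSpace A]
    [MeasurableSpace B] {κ : Θ → Measure A} {η : Θ → Measure B}
    [∀ w, IsProbabilityMeasure (κ w)] [∀ w, IsProbabilityMeasure (η w)]
    (hκ : Measurable κ) (hη : Measurable η) : Measurable fun w => (κ w).prod (η w) := by
  let κ' : Kernel Θ A := ⟨κ, hκ⟩
  let η' : Kernel Θ B := ⟨η, hη⟩
  have : IsMarkovKernel κ' := ⟨‹_›⟩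
  have : IsMarkovKernel η' := ⟨‹_›⟩
  have hprod : (fun w => (κ w).prod (η w)) = κ' ×ₖ η' :=
    funext fun w => (Kernel.prod_apply κ' η' w).symm
  exact hprod ▸ (κ' ×ₖ η').measurable

theorem measurable_sampleLaw {μ : Env d → Sym2 (Site d) → Measure ℕ}
    [∀ w ε, IsProbabilityMeasure (μ w ε)] (hμ : ∀ ε, Measurable fun w => μ w ε) (ρ : Measure ℝ)
    [IsProbabilityMeasure ρ] : Measurable fun w => sampleLaw (μ w) ρ :=
  measurable_measure_prod
    (measurable_measure_prod (measurable_infinitePi hμ) measurable_const)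
    (measurable_measure_prod (measurable_infinitePi fun _ => hμ _) measurable_const)

theorem hasLawInEnv_compProd {Θ S : Type} [MeasurableSpace Θ] [MeasurableSpace S] (ν : Measure ℝ)
    [IsProbabilityMeasure ν] (κ : Kernel (Env d) Θ) [IsMarkovKernel κ] {f : Θ → S}
    {Q : Env d → Measure S} (h : ∀ w, MeasurePreserving f (κ w) (Q w)) :
    HasLawInEnv ((Measure.infinitePi fun _ : Site d => ν) ⊗ₘ κ) ν Prod.fst
      (fun ω => f ω.2) Q := by
  have hf : Measurable f := (h fun _ => 0).measurable
  refine ⟨measurable_fst, hf.comp measurable_snd, fun A B hA hB => ?_⟩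
  have hprod : Prod.fst ⁻¹' A ∩ (fun ω : Env d × Θ => f ω.2) ⁻¹' B = A ×ˢ (f ⁻¹' B) := rfl
  rw [hprod, Measure.compProd_apply_prod hA (hf hB)]
  simp_rw [(h _).measure_preimage hB.nullMeasurableSet]

end Laws

/-! ### Poisson numbers of connections -/

section Poisson

theorem map_eq_bernoulliMeasure {A S : Type*} [MeasurableSpace A] [MeasurableSpace S]
    {m : Measure A} [IsProbabilityMeasure m] {a : Set A} (ha : MeasurableSet a)
    {p : unitInterval} (hp : m.real a = p) {f : A → S} (hf : Measurable f) {u v : S}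
    (hu : ∀ x ∈ a, f x = u) (hv : ∀ x ∉ a, f x = v) : m.map f = bernoulliMeasure u v p := by
  have map_restrict : ∀ {b : Set A} {q : unitInterval} {y : S}, MeasurableSet b → m.real b = q →
      (∀ x ∈ b, f x = y) → (m.restrict b).map f = unitInterval.toNNReal q • Measure.dirac y :=
    fun {b q y} hb hq hy => by
      have hmass : m b = unitInterval.toNNReal q := by
        rw [← ofReal_measureReal, hq, ← unitInterval.coe_toNNReal, ENNReal.ofReal_coe_nnreal]
      rw [Measure.map_congr (ae_restrict_of_forall_mem hb hy), Measure.map_const,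
        Measure.restrict_apply_univ, hmass]
      rfl
  have hcompl : m.real aᶜ = unitInterval.symm p := by
    rw [probReal_compl_eq_one_sub ha, hp, unitInterval.coe_symm_eq]
  rw [← Measure.restrict_add_restrict_compl (μ := m) ha, Measure.map_add _ _ hf,
    map_restrict ha hp hu, map_restrict ha.compl hcompl hv, bernoulliMeasure_def]

theorem measurable_poissonMeasure : Measurable poissonMeasure := by
  refine Measure.measurable_of_measurable_coe _ fun s hs => ?_
  simp_rw [poissonMeasure, Measure.sum_apply _ hs, Measure.smul_apply, smul_eq_mul]
  fun_prop

variable {d : ℕ} (α lam : ℝ)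

theorem measurable_rate (x y : Site d) : Measurable fun w : Env d => rate α lam w x y := by
  unfold rate
  split_ifs
  · exact measurable_const
  · fun_prop

theorem measurable_poiOffspring (x y : Site d) :
    Measurable fun w : Env d => poiOffspring α lam w x y := by
  have hpoisson := measurable_poissonMeasure.comp (measurable_rate α lam x y)
  unfold poiOffspring
  split_ifs
  · exact (Measure.measurable_map _ .of_discrete).comp hpoisson
  · exact hpoisson

instance (w : Env d) (x y : Site d) : IsProbabilityMeasure (poiOffspring α lam w x y) := by
  unfold poiOffspring
  split_ifs
  · exact Measure.isProbabilityMeasure_map Measurable.of_discrete.aemeasurable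
  · infer_instance

theorem poiOffspring_comm (w : Env d) (x y : Site d) :
    poiOffspring α lam w x y = poiOffspring α lam w y x := by
  unfold poiOffspring
  simp only [eucl_comm x y, rate_comm α lam w x y]

theorem poiOffspring_real_compl_zero (w : Env d) (x y : Site d) :
    (poiOffspring α lam w x y).real {0}ᶜ = connProb α lam w x y := by
  rw [probReal_compl_eq_one_sub (.singleton 0)]
  unfold poiOffspring connProb
  split_ifs
  · rw [map_measureReal_apply .of_discrete (.singleton 0)]
    have hempty : (fun n : ℕ => n + 1) ⁻¹' {0} = ∅ := by ext n; simp
    simp [hempty]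
  · simp [poissonMeasure_real_singleton]

/-- The law of the number of connections of an unordered pair of sites. -/
noncomputable def connLaw (w : Env d) : Sym2 (Site d) → Measure ℕ :=
  Sym2.lift ⟨poiOffspring α lam w, poiOffspring_comm α lam w⟩

instance (w : Env d) (ε : Sym2 (Site d)) : IsProbabilityMeasure (connLaw α lam w ε) := by
  induction ε with
  | _ x y => exact inferInstanceAs (IsProbabilityMeasure (poiOffspring α lam w x y))

theorem measurable_connLaw (ε : Sym2 (Site d)) :
    Measurable fun w : Env d => connLaw α lam w ε := by
  induction ε with
  | _ x y => exact measurable_poiOffspring α lam x y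

theorem map_connLaw_eq_bernoulliMeasure {S : Type*} [MeasurableSpace S] (w : Env d)
    (ε : Sym2 (Site d)) {f : ℕ → S} {u v : S} (hu : ∀ n, n ≠ 0 → f n = u) (hv : f 0 = v) :
    (connLaw α lam w ε).map f = bernoulliMeasure u v (connProbSym α lam w ε) := by
  induction ε with
  | _ x y =>
    exact map_eq_bernoulliMeasure (MeasurableSet.singleton 0).compl
      (poiOffspring_real_compl_zero α lam w x y) .of_discrete hu (by simpa using hv)

theorem map_decide_connLaw (w : Env d) (ε : Sym2 (Site d)) :
    (connLaw α lam w ε).map (fun n => decide (1 ≤ n)) =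
      bernoulliMeasure true false (connProbSym α lam w ε) :=
  map_connLaw_eq_bernoulliMeasure α lam w ε
    (fun _ hn => by simpa [Nat.one_le_iff_ne_zero] using hn) rfl

theorem map_min_connLaw (w : Env d) (x y : Site d) :
    (connLaw α lam w s(x, y)).map (min 1) = berOffspring α lam w x y :=
  map_connLaw_eq_bernoulliMeasure α lam w s(x, y)
    (fun _ hn => min_eq_left (Nat.one_le_iff_ne_zero.2 hn)) rfl

end Poisson

end SFPCoupling

theorem mainTheorem9_general (d : ℕ) (μ : Env d → Sym2 (Site d) → Measure ℕ)
    [∀ w ε, IsProbabilityMeasure (μ w ε)] (hμ : ∀ ε, Measurable fun w => μ w ε)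
    (ν ρ : Measure ℝ) [IsProbabilityMeasure ν] [IsProbabilityMeasure ρ]
    (hρ : ∀ᵐ l ∂ρ, 0 ≤ l) (e : Site d ↪ ℕ) :
    ∃ (Ω : Type) (_ : MeasurableSpace Ω) (P : Measure Ω) (_ : IsProbabilityMeasure P)
      (W : Ω → Env d) (XS : Ω → EdgeConf d) (XB XP : Ω → BRWConf d),
      HasLawInEnv P ν W XS (fun w =>
        (Measure.infinitePi fun ε => (μ w ε).map fun n => decide (1 ≤ n)).prod
          (Measure.infinitePi fun _ => ρ)) ∧
      HasLawInEnv P ν W XB (fun w => brwLaw (fun x y => (μ w s(x, y)).map (min 1)) ρ) ∧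
      HasLawInEnv P ν W XP (fun w => brwLaw (fun x y => μ w s(x, y)) ρ) ∧
      (∀ᵐ ω ∂P, IsThinning (XB ω) (XP ω)) ∧
      ∀ᵐ ω ∂P, ∃ φ : Site d → Indiv d, ∀ t : ℝ, 0 ≤ t →
        (shortestPathTree e (W ω) (XS ω) t).IsSubgraphVia φ (brwBall (W ω) (XB ω) t) ∧
        (brwBall (W ω) (XB ω) t).IsSubgraphVia id (brwBall (W ω) (XP ω) t) := by
  let κ : Kernel (Env d) (EdgeMarks d × BRWConf d) :=
    ⟨fun w => sampleLaw (μ w) ρ, measurable_sampleLaw hμ ρ⟩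
  have hκ : IsMarkovKernel κ :=
    ⟨fun w => inferInstanceAs (IsProbabilityMeasure (sampleLaw (μ w) ρ))⟩
  have hexplored := fun w => measurePreserving_exploredBRW (μ w) ρ e
  refine ⟨Env d × (EdgeMarks d × BRWConf d), inferInstance,
    (Measure.infinitePi fun _ : Site d => ν) ⊗ₘ κ, inferInstance,
    Prod.fst, fun ω => toEdgeConf ω.2.1, fun ω => thin (exploredBRW e ω.2),
    fun ω => exploredBRW e ω.2,
    hasLawInEnv_compProd ν κ fun w => measurePreserving_toEdgeConf_sampleLaw (μ w) ρ,
    hasLawInEnv_compProd ν κ fun w => (measurePreserving_thin _ ρ).comp (hexplored w),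
    hasLawInEnv_compProd ν κ hexplored, ae_of_all _ fun ω => isThinning_thin _, ?_⟩
  have hnonneg : ∀ᵐ ω ∂((Measure.infinitePi fun _ : Site d => ν) ⊗ₘ κ), ∀ ε, 0 ≤ ω.2.1.2 ε :=
    Measure.ae_compProd_of_ae_ae (measurableSet_setOfPred.2 (by fun_prop))
      (ae_of_all _ fun w => ae_nonneg_sampleLaw (μ w) ρ hρ)
  filter_upwards [hnonneg] with ω hω
  exact ⟨embedding e ω.2.1, fun t _ =>
    ⟨shortestPathTree_isSubgraphVia e ω.1 ω.2.2 hω t, brwBall_thin_isSubgraphVia ω.1 _ t⟩⟩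

theorem mainTheorem9 (d : ℕ) (α lam : ℝ) (hα : 0 < α) (hlam : 0 < lam)
    (ν ρ : Measure ℝ) [IsProbabilityMeasure ν] [IsProbabilityMeasure ρ]
    (hν : ∀ᵐ x ∂ν, 1 ≤ x) (hρ : ∀ᵐ l ∂ρ, 0 ≤ l) (e : Site d ↪ ℕ) :
    ∃ (Ω : Type) (_ : MeasurableSpace Ω) (P : Measure Ω) (_ : IsProbabilityMeasure P)
      (W : Ω → Env d) (XS : Ω → EdgeConf d) (XB XP : Ω → BRWConf d),
      HasLawInEnv P ν W XS (fun w => sfpLaw α lam ρ w) ∧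
      HasLawInEnv P ν W XB (fun w => brwLaw (berOffspring α lam w) ρ) ∧
      HasLawInEnv P ν W XP (fun w => brwLaw (poiOffspring α lam w) ρ) ∧
      (∀ᵐ ω ∂P, IsThinning (XB ω) (XP ω)) ∧
      ∀ᵐ ω ∂P, ∃ φ : Site d → Indiv d, ∀ t : ℝ, 0 ≤ t →
        (shortestPathTree e (W ω) (XS ω) t).IsSubgraphVia φ (brwBall (W ω) (XB ω) t) ∧
        (brwBall (W ω) (XB ω) t).IsSubgraphVia id (brwBall (W ω) (XP ω) t) := by
  have hgeneral := mainTheorem9_general d (connLaw α lam) (measurable_connLaw α lam) ν ρ hρ e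
  simp only [map_decide_connLaw, map_min_connLaw] at hgeneral
  exact hgeneral
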